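/- Let $\Lambda$ be the ring of symmetric functions with rational coefficients in the variables $x_1,x_2,\dots$, that is, the formal power series of bounded degree that are invariant under all permutations of the variables. For $k\ge 1$ let $p_k=x_1^k+x_2^k+\cdots$, and for a partition $\lambda=(\lambda_1,\dots,\lambda_\ell)$ of $n\ge 0$ into $\ell$ parts let $p_\lambda=p_{\lambda_1}\cdots p_{\lambda_\ell}$. The $p_\lambda$ form a basis of $\Lambda$; let $\omega:\Lambda\to\Lambda$ be the linear map with $$\omega(p_\lambda)=(-1)^{n-\ell}p_\lambda$$ for every partition $\lambda$ of $n$ into $\ell$ parts. Let $G=(V,E)$ be a finite simple graph. A $\mathbb{P}$-coloring of $G$ is a function $\kappa:V\to\{1,2,3,\dots\}$; it is proper if $\kappa(u)\ne\kappa(v)$ for every edge $uv$. Write $\mathbf{x}^\kappa=\prod_{v\in V}x_{\kappa(v)}$, and let $X(G;\mathbf{x})=\sum_\kappa \mathbf{x}^\kappa$, summed over all proper $\mathbb{P}$-colorings $\kappa$ of $G$, be the chromatic symmetric function of $G$. An orientation $O$ of $G$ is obtained by replacing each edge $uv$ by exactly one of the arcs $\overrightarrow{uv}$, $\overrightarrow{vu}$;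 it is acyclic if it contains no directed cycle, and it is compatible with a $\mathbb{P}$-coloring $\kappa$ if $\kappa(u)\le\kappa(v)$ for every arc $\overrightarrow{uv}$ of $O$. **Theorem (Stanley).** For every finite simple graph $G$, $$\omega(X(G;\mathbf{x}))=\sum_{(O,\kappa)}\mathbf{x}^\kappa,$$ where the sum is over all pairs $(O,\kappa)$ in which $O$ is an acyclic orientation of $G$ and $\kappa$ is a (not necessarily proper) $\mathbb{P}$-coloring of $G$ that is compatible with $O$. -/

import Mathlib

namespace ChromSym

/-! ### Formal sums of monomials in the variables `x₁, x₂, …` -/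

/-- The formal sum `∑ i, x ^ (w i)` of the monomials with exponents `w i`, for a family in which
every monomial occurs finitely often: the coefficient of `x ^ d` is the number of indices `i` with
`w i = d`. -/
noncomputable def formalSum {ι : Type*} (w : ι → (ℕ+ →₀ ℕ)) : MvPowerSeries ℕ+ ℚ :=
  fun d => (Nat.card {i // w i = d} : ℚ)

theorem coeff_formalSum {ι : Type*} (w : ι → (ℕ+ →₀ ℕ)) (d : ℕ+ →₀ ℕ) :
    MvPowerSeries.coeff d (formalSum w) = (Nat.card {i // w i = d} : ℚ) := rfl

/-! ### The ring of symmetric functions -/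

theorem coeff_rename_equiv (e : Equiv.Perm ℕ+) (f : MvPowerSeries ℕ+ ℚ) (d : ℕ+ →₀ ℕ) :
    MvPowerSeries.coeff (d.mapDomain e) (MvPowerSeries.rename e f) = MvPowerSeries.coeff d f := by
  have h := MvPowerSeries.coeff_embDomain_rename e.toEmbedding f d
  rw [Finsupp.embDomain_eq_mapDomain] at h
  exact h

/-- The ring `Λ` of symmetric functions with rational coefficients in `x₁, x₂, …`: the formal power
series of bounded degree that are invariant under every permutation of the variables. -/
noncomputable def symFun : Subalgebra ℚ (MvPowerSeries ℕ+ ℚ) where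
  carrier := {f | (∀ e : Equiv.Perm ℕ+, MvPowerSeries.rename e f = f) ∧
    ∃ N : ℕ, ∀ d : ℕ+ →₀ ℕ, MvPowerSeries.coeff d f ≠ 0 → d.degree ≤ N}
  mul_mem' := by
    rintro f g ⟨hf, N, hN⟩ ⟨hg, M, hM⟩
    refine ⟨fun e => by rw [map_mul, hf, hg], N + M, fun d hd => ?_⟩
    classical
    rw [MvPowerSeries.coeff_mul] at hd
    obtain ⟨p, hp, hne⟩ := Finset.exists_ne_zero_of_sum_ne_zero hd
    rw [← Finset.HasAntidiagonal.mem_antidiagonal.mp hp, map_add]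
    exact add_le_add (hN _ (left_ne_zero_of_mul hne)) (hM _ (right_ne_zero_of_mul hne))
  add_mem' := by
    rintro f g ⟨hf, N, hN⟩ ⟨hg, M, hM⟩
    refine ⟨fun e => by rw [map_add, hf, hg], max N M, fun d hd => ?_⟩
    rw [map_add] at hd
    by_cases h : MvPowerSeries.coeff d f = 0
    · rw [h, zero_add] at hd
      exact (hM d hd).trans (le_max_right _ _)
    · exact (hN d h).trans (le_max_left _ _)
  algebraMap_mem' := by
    intro r
    refine ⟨fun e => AlgHom.commutes _ r, 0, fun d hd => ?_⟩
    classical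
    by_contra h
    apply hd
    have : d ≠ 0 := by rintro rfl; simp at h
    rw [MvPowerSeries.algebraMap_apply, MvPowerSeries.coeff_C, if_neg this]

/-- A formal sum of monomials of bounded degree is symmetric if every permutation of the variables
lifts to a permutation of the index set. -/
theorem formalSum_mem {ι : Type*} (w : ι → (ℕ+ →₀ ℕ)) (N : ℕ) (hN : ∀ i, (w i).degree ≤ N)
    (hs : ∀ e : Equiv.Perm ℕ+, ∃ s : Equiv.Perm ι, ∀ i, w (s i) = (w i).mapDomain e) :
    formalSum w ∈ symFun := by
  refine ⟨fun e => ?_, N, fun d hd => ?_⟩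
  · ext d
    obtain ⟨d, rfl⟩ : ∃ d', d = Finsupp.mapDomain e d' :=
      ⟨d.mapDomain e.symm, by rw [← Finsupp.mapDomain_comp]; simp [Finsupp.mapDomain_id]⟩
    rw [coeff_rename_equiv, coeff_formalSum, coeff_formalSum]
    obtain ⟨s, hs⟩ := hs e
    congr 1
    refine Nat.card_congr (s.subtypeEquiv fun i => ?_)
    rw [hs]
    exact (Finsupp.mapDomain_injective e.injective).eq_iff.symm
  · rw [coeff_formalSum] at hd
    have : Nonempty {i // w i = d} := by
      by_contra h
      rw [not_nonempty_iff] at h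
      exact hd (by simp)
    obtain ⟨i, rfl⟩ := this
    exact hN i

/-! ### Power sums -/

/-- The power sum `p_k = x₁ ^ k + x₂ ^ k + ⋯` (used for `k ≥ 1` only). -/
noncomputable def powerSum (k : ℕ) : symFun :=
  ⟨formalSum fun i : ℕ+ => Finsupp.single i k,
    formalSum_mem _ k (fun i => (Finsupp.degree_single i k).le)
      fun e => ⟨e, fun i => by rw [Finsupp.mapDomain_single]⟩⟩

/-- The power sum `p_λ = p_{λ₁} ⋯ p_{λ_ℓ}` of a partition `λ` of a natural number `n`. -/
noncomputable def powerSumPart (l : Σ n : ℕ, n.Partition) : symFun :=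
  (l.2.parts.map powerSum).prod

/-! ### The power sums `p_λ` form a basis of `Λ` -/

/-- The multiset of the nonzero exponents of a monomial. -/
def shape (d : ℕ+ →₀ ℕ) : Multiset ℕ := d.support.val.map d

theorem card_shape (d : ℕ+ →₀ ℕ) : (shape d).card = d.support.card := by
  simp [shape]

theorem sum_shape (d : ℕ+ →₀ ℕ) : (shape d).sum = d.degree := rfl

theorem pos_of_mem_shape {d : ℕ+ →₀ ℕ} {k : ℕ} (h : k ∈ shape d) : 0 < k := by
  obtain ⟨i, hi, rfl⟩ := Multiset.mem_map.mp h
  exact Nat.pos_of_ne_zero (Finsupp.mem_support_iff.mp hi)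

theorem shape_single_add {i : ℕ+} {k : ℕ} (hk : 0 < k) {b : ℕ+ →₀ ℕ} (hi : i ∉ b.support) :
    shape (Finsupp.single i k + b) = k ::ₘ shape b := by
  classical
  have hd : Disjoint (Finsupp.single i k).support b.support := by
    rw [Finsupp.support_single i hk.ne']
    simpa using hi
  have hs : (Finsupp.single i k + b).support = insert i b.support := by
    rw [Finsupp.support_add_eq hd, Finsupp.support_single i hk.ne']
    rfl
  have hbi : b i = 0 := Finsupp.notMem_support_iff.mp hi
  rw [shape, hs, Finset.insert_val_of_notMem hi, Multiset.map_cons]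
  congr 1
  · simp [hbi]
  · refine Multiset.map_congr rfl fun j hj => ?_
    have hji : i ≠ j := by rintro rfl; exact hi hj
    simp [hji]

theorem exists_shape_eq (s : Multiset ℕ) : (∀ k ∈ s, 0 < k) → ∃ d : ℕ+ →₀ ℕ, shape d = s := by
  induction s using Multiset.induction_on with
  | empty => exact fun _ => ⟨0, by simp [shape]⟩
  | cons k s ih =>
    intro h
    obtain ⟨b, hb⟩ := ih fun j hj => h j (Multiset.mem_cons_of_mem hj)
    obtain ⟨i, hi⟩ := Infinite.exists_notMem_finset b.support
    exact ⟨Finsupp.single i k + b, by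
      rw [shape_single_add (h k (Multiset.mem_cons_self k s)) hi, hb]⟩

theorem exists_perm_of_shape_eq {d d' : ℕ+ →₀ ℕ} (h : shape d = shape d') :
    ∃ e : Equiv.Perm ℕ+, d.mapDomain e = d' := by
  classical
  have hfin : ∀ (c : ℕ+ →₀ ℕ) (k : ℕ), 0 < k →
      Finite {i // c i = k} ∧ Nat.card {i // c i = k} = (shape c).count k := by
    intro c k hk
    have hset : {i | c i = k} = ↑(c.support.filter fun i => k = c i) := by
      ext i
      simp only [Set.mem_ofPred_eq, Finset.coe_filter, Finsupp.mem_support_iff]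
      constructor
      · rintro rfl
        exact ⟨hk.ne', rfl⟩
      · exact fun hh => hh.2.symm
    refine ⟨(hset ▸ Finset.finite_toSet _ : {i | c i = k}.Finite).to_subtype, ?_⟩
    change Nat.card ({i | c i = k} : Set ℕ+) = _
    rw [hset, Nat.card_coe_set_eq, Set.ncard_coe_finset, shape, Multiset.count_map]
    rfl
  have hinf : ∀ c : ℕ+ →₀ ℕ, Infinite {i // c i = 0} := by
    intro c
    have : ({i | c i = 0} : Set ℕ+) = (↑c.support : Set ℕ+)ᶜ := by
      ext i; simp
    have h2 : ({i | c i = 0} : Set ℕ+).Infinite := this ▸ c.support.finite_toSet.infinite_compl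
    exact h2.to_subtype
  have he : ∀ k : ℕ, Nonempty ({i // d i = k} ≃ {i // d' i = k}) := by
    intro k
    rcases Nat.eq_zero_or_pos k with rfl | hk
    · have := hinf d
      have := hinf d'
      exact nonempty_equiv_of_countable
    · have h1 := hfin d k hk
      have h2 := hfin d' k hk
      have := h1.1
      have := h2.1
      exact Finite.card_eq.mp (by rw [h1.2, h2.2, h])
  let e : Equiv.Perm ℕ+ := Equiv.ofFiberEquiv fun k => (he k).some
  refine ⟨e, Finsupp.ext fun j => ?_⟩
  obtain ⟨i, rfl⟩ := e.surjective j
  rw [Finsupp.mapDomain_apply e.injective]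
  exact (Equiv.ofFiberEquiv_map (fun k => (he k).some) i).symm

theorem coeff_eq_of_shape_eq (f : symFun) {d d' : ℕ+ →₀ ℕ} (h : shape d = shape d') :
    MvPowerSeries.coeff d (f : MvPowerSeries ℕ+ ℚ) = MvPowerSeries.coeff d' f.1 := by
  obtain ⟨e, rfl⟩ := exists_perm_of_shape_eq h
  rw [← coeff_rename_equiv e, f.2.1 e]

theorem coeff_powerSum_nonneg (k : ℕ) (d : ℕ+ →₀ ℕ) :
    0 ≤ MvPowerSeries.coeff d (powerSum k).1 := by
  change 0 ≤ MvPowerSeries.coeff d (formalSum _)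
  rw [coeff_formalSum]
  positivity

theorem exists_of_coeff_powerSum_ne_zero {k : ℕ} {d : ℕ+ →₀ ℕ}
    (h : MvPowerSeries.coeff d (powerSum k).1 ≠ 0) : ∃ i, d = Finsupp.single i k := by
  change MvPowerSeries.coeff d (formalSum _) ≠ 0 at h
  rw [coeff_formalSum] at h
  by_contra hcon
  push Not at hcon
  have : IsEmpty {i : ℕ+ // Finsupp.single i k = d} := ⟨fun i => hcon i.1 i.2.symm⟩
  exact h (by simp)

theorem coeff_powerSum_single_pos {k : ℕ} (hk : 0 < k) (i : ℕ+) :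
    0 < MvPowerSeries.coeff (Finsupp.single i k) (powerSum k).1 := by
  change 0 < MvPowerSeries.coeff _ (formalSum _)
  rw [coeff_formalSum]
  have h1 : Subsingleton {j : ℕ+ // Finsupp.single j k = Finsupp.single i k} :=
    ⟨fun a b => Subtype.ext (Finsupp.single_left_injective hk.ne' (a.2.trans b.2.symm))⟩
  have h2 : Nonempty {j : ℕ+ // Finsupp.single j k = Finsupp.single i k} := ⟨⟨i, rfl⟩⟩
  exact_mod_cast Nat.card_pos

theorem coeff_prod_powerSum (s : Multiset ℕ) : (∀ k ∈ s, 0 < k) → ∀ d : ℕ+ →₀ ℕ,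
    0 ≤ MvPowerSeries.coeff d ((s.map powerSum).prod).1 ∧
    (MvPowerSeries.coeff d ((s.map powerSum).prod).1 ≠ 0 →
      d.support.card ≤ s.card ∧ (d.support.card = s.card → shape d = s) ∧ d.degree = s.sum) ∧
    (shape d = s → 0 < MvPowerSeries.coeff d ((s.map powerSum).prod).1) := by
  classical
  induction s using Multiset.induction_on with
  | empty =>
    intro _ d
    simp only [Multiset.map_zero, Multiset.prod_zero, OneMemClass.coe_one,
      MvPowerSeries.coeff_one]
    refine ⟨by split_ifs <;> norm_num, fun h => ?_, fun h => ?_⟩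
    · have : d = 0 := by by_contra hd; simp [hd] at h
      subst this
      simp [shape]
    · have : d = 0 := by simpa [shape] using h
      simp [this]
  | cons k s ih =>
    intro hpos d
    have hk : 0 < k := hpos k (Multiset.mem_cons_self k s)
    have ih := ih fun j hj => hpos j (Multiset.mem_cons_of_mem hj)
    simp only [Multiset.map_cons, Multiset.prod_cons, MulMemClass.coe_mul,
      MvPowerSeries.coeff_mul, Multiset.card_cons]
    have hnn : ∀ p ∈ Finset.HasAntidiagonal.antidiagonal d, 0 ≤ MvPowerSeries.coeff p.1 (powerSum k).1 *
        MvPowerSeries.coeff p.2 ((s.map powerSum).prod).1 := fun p _ =>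
      mul_nonneg (coeff_powerSum_nonneg k p.1) (ih p.2).1
    refine ⟨Finset.sum_nonneg hnn, fun h => ?_, fun h => ?_⟩
    · obtain ⟨p, hp, hne⟩ := Finset.exists_ne_zero_of_sum_ne_zero h
      obtain ⟨i, hi⟩ := exists_of_coeff_powerSum_ne_zero (left_ne_zero_of_mul hne)
      obtain ⟨hc, hsh, hdeg⟩ := (ih p.2).2.1 (right_ne_zero_of_mul hne)
      have hd := Finset.HasAntidiagonal.mem_antidiagonal.mp hp
      rw [hi] at hd
      have hsub : d.support ⊆ insert i p.2.support := by
        rw [← hd]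
        refine Finsupp.support_add.trans ?_
        refine Finset.union_subset (Finsupp.support_single_subset.trans ?_)
          (Finset.subset_insert _ _)
        simp
      have hle := Finset.card_le_card hsub
      have hdeg : d.degree = (k ::ₘ s).sum := by
        rw [← hd, map_add, Finsupp.degree_single, hdeg, Multiset.sum_cons]
      by_cases hmem : i ∈ p.2.support
      · rw [Finset.insert_eq_of_mem hmem] at hle
        exact ⟨by omega, fun hh => by omega, hdeg⟩
      · rw [Finset.card_insert_of_notMem hmem] at hle
        refine ⟨by omega, fun hh => ?_, hdeg⟩
        rw [← hd, shape_single_add hk hmem, hsh (by omega)]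
    · have hkm : k ∈ shape d := h ▸ Multiset.mem_cons_self k s
      obtain ⟨i, -, hik⟩ := Multiset.mem_map.mp hkm
      have hd : Finsupp.single i k + d.erase i = d := by
        rw [← hik]; exact Finsupp.single_add_erase i d
      have hb : shape (d.erase i) = s := by
        have h2 := shape_single_add hk (b := d.erase i) (i := i) (by simp)
        rw [hd, h] at h2
        exact ((Multiset.cons_inj_right k).mp h2).symm
      refine lt_of_lt_of_le ?_ (Finset.single_le_sum hnn
        (Finset.HasAntidiagonal.mem_antidiagonal.mpr hd : (Finsupp.single i k, d.erase i) ∈ _))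
      exact mul_pos (coeff_powerSum_single_pos hk i) ((ih _).2.2 hb)

/-- The partition formed by the nonzero exponents of a monomial. -/
noncomputable def shapePart (d : ℕ+ →₀ ℕ) : Σ n : ℕ, n.Partition :=
  ⟨d.degree, ⟨shape d, fun h => pos_of_mem_shape h, sum_shape d⟩⟩

theorem part_ext {l m : Σ n : ℕ, n.Partition} (h : l.2.parts = m.2.parts) : l = m := by
  obtain ⟨n, l⟩ := l
  obtain ⟨k, m⟩ := m
  have hnk : n = k := by rw [← l.parts_sum, ← m.parts_sum]; exact congrArg _ h
  subst hnk
  congr 1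
  exact Nat.Partition.ext h

theorem exists_shapePart_eq (l : Σ n : ℕ, n.Partition) : ∃ d, shapePart d = l := by
  obtain ⟨d, hd⟩ := exists_shape_eq l.2.parts fun k hk => l.2.parts_pos hk
  exact ⟨d, part_ext hd⟩

theorem coeff_powerSumPart_ne_zero {l : Σ n : ℕ, n.Partition} {d : ℕ+ →₀ ℕ}
    (h : MvPowerSeries.coeff d (powerSumPart l).1 ≠ 0) :
    d.support.card ≤ l.2.parts.card ∧ (d.support.card = l.2.parts.card → shapePart d = l) ∧
      d.degree = l.1 := by
  obtain ⟨h1, h2, h3⟩ := (coeff_prod_powerSum l.2.parts (fun k hk => l.2.parts_pos hk) d).2.1 h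
  exact ⟨h1, fun hh => part_ext (h2 hh), h3.trans l.2.parts_sum⟩

theorem coeff_powerSumPart_shapePart_ne_zero (d : ℕ+ →₀ ℕ) :
    MvPowerSeries.coeff d (powerSumPart (shapePart d)).1 ≠ 0 :=
  ((coeff_prod_powerSum (shape d) (fun _ hk => pos_of_mem_shape hk) d).2.2 rfl).ne'

theorem coeff_coe_sum {α : Type*} (t : Finset α) (c : α → ℚ) (g : α → symFun) (d : ℕ+ →₀ ℕ) :
    MvPowerSeries.coeff d (∑ l ∈ t, c l • g l : symFun).1 =
      ∑ l ∈ t, c l * MvPowerSeries.coeff d (g l).1 := by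
  have : (∑ l ∈ t, c l • g l : symFun).1 = ∑ l ∈ t, c l • (g l).1 := by
    simp
  rw [this, map_sum]
  rfl

theorem linearIndependent_powerSumPart : LinearIndependent ℚ powerSumPart := by
  classical
  rw [linearIndependent_iff']
  intro t c hc
  by_contra hcon
  push Not at hcon
  obtain ⟨l₀, hl₀, hcl₀⟩ := hcon
  obtain ⟨m, hm, hmax⟩ := (t.filter fun l => c l ≠ 0).exists_max_image (fun l => l.2.parts.card)
    ⟨l₀, Finset.mem_filter.mpr ⟨hl₀, hcl₀⟩⟩
  obtain ⟨hmt, hcm⟩ := Finset.mem_filter.mp hm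
  obtain ⟨d, rfl⟩ := exists_shapePart_eq m
  have h0 := coeff_coe_sum t c powerSumPart d
  rw [hc, Finset.sum_eq_single_of_mem _ hmt] at h0
  · exact mul_ne_zero hcm (coeff_powerSumPart_shapePart_ne_zero d) h0.symm
  · intro l hl hne
    by_contra hmul
    obtain ⟨h1, h2, -⟩ := coeff_powerSumPart_ne_zero (right_ne_zero_of_mul hmul)
    have h3 := hmax l (Finset.mem_filter.mpr ⟨hl, left_ne_zero_of_mul hmul⟩)
    have h4 : (shapePart d).2.parts.card = d.support.card := card_shape d
    exact hne (h2 (by omega)).symm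

theorem mem_span_powerSumPart (N L : ℕ) : ∀ f : symFun,
    (∀ d, MvPowerSeries.coeff d f.1 ≠ 0 → d.degree ≤ N ∧ d.support.card < L) →
    f ∈ Submodule.span ℚ (Set.range powerSumPart) := by
  classical
  induction L with
  | zero =>
    intro f hf
    have : f = 0 := by
      apply Subtype.ext
      ext d
      by_contra h
      exact absurd (hf d h).2 (by omega)
    rw [this]
    exact Submodule.zero_mem _
  | succ L ih =>
    intro f hf
    choose r hr using exists_shapePart_eq
    let t : Finset (Σ n : ℕ, n.Partition) :=
      ((Finset.range (N + 1)).sigma fun n => (Finset.univ : Finset n.Partition)).filter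
        fun l => l.2.parts.card = L
    let c : (Σ n : ℕ, n.Partition) → ℚ := fun l =>
      MvPowerSeries.coeff (r l) f.1 / MvPowerSeries.coeff (r l) (powerSumPart l).1
    let g : symFun := ∑ l ∈ t, c l • powerSumPart l
    have hg : g ∈ Submodule.span ℚ (Set.range powerSumPart) :=
      Submodule.sum_mem _ fun l _ => Submodule.smul_mem _ _ (Submodule.subset_span ⟨l, rfl⟩)
    have hfg : f - g ∈ Submodule.span ℚ (Set.range powerSumPart) := by
      refine ih _ fun d hd => ?_
      have hsub : MvPowerSeries.coeff d (f - g).1 =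
          MvPowerSeries.coeff d f.1 - MvPowerSeries.coeff d g.1 := rfl
      rw [hsub, coeff_coe_sum] at hd
      have hN : d.degree ≤ N ∧ d.support.card ≤ L := by
        by_cases h : MvPowerSeries.coeff d f.1 = 0
        · rw [h, zero_sub, neg_ne_zero] at hd
          obtain ⟨l, hl, hne⟩ := Finset.exists_ne_zero_of_sum_ne_zero hd
          have hne := right_ne_zero_of_mul hne
          obtain ⟨h1, -, h2⟩ := coeff_powerSumPart_ne_zero hne
          simp only [t, Finset.mem_filter, Finset.mem_sigma, Finset.mem_range] at hl
          omega
        · have := hf d h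
          omega
      refine ⟨hN.1, lt_of_le_of_ne hN.2 fun hL => hd ?_⟩
      have hmem : shapePart d ∈ t := by
        simp only [t, Finset.mem_filter, Finset.mem_sigma, Finset.mem_range, Finset.mem_univ,
          and_true]
        exact ⟨Nat.lt_succ_of_le hN.1, (card_shape d).trans hL⟩
      rw [Finset.sum_eq_single_of_mem _ hmem]
      · have hsh : shape (r (shapePart d)) = shape d := by
          have := hr (shapePart d)
          exact congrArg (fun l : (Σ n : ℕ, n.Partition) => l.2.parts) this
        simp only [c]
        rw [coeff_eq_of_shape_eq f hsh, coeff_eq_of_shape_eq (powerSumPart _) hsh,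
          div_mul_cancel₀ _ (coeff_powerSumPart_shapePart_ne_zero d), sub_self]
      · intro l hl hne
        by_contra hmul
        obtain ⟨-, h2, -⟩ := coeff_powerSumPart_ne_zero (right_ne_zero_of_mul hmul)
        have h3 : l.2.parts.card = L := (Finset.mem_filter.mp hl).2
        exact hne (h2 (by omega)).symm
    have := Submodule.add_mem _ hfg hg
    rwa [sub_add_cancel] at this

/-- The power sums `p_λ`, as a basis of the ring of symmetric functions. -/
noncomputable def powerSumBasis : Module.Basis (Σ n : ℕ, n.Partition) ℚ symFun :=
  Module.Basis.mk linearIndependent_powerSumPart (by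
    intro f _
    obtain ⟨N, hN⟩ := f.2.2
    refine mem_span_powerSumPart N (N + 1) f fun d hd => ⟨hN d hd, ?_⟩
    refine Nat.lt_succ_of_le (le_trans ?_ (hN d hd))
    rw [← card_shape, ← sum_shape]
    have := Multiset.card_nsmul_le_sum (s := shape d) (a := 1) fun k hk => pos_of_mem_shape hk
    simpa using this)

/-! ### The involution `ω` -/

/-- The linear map `ω` on the ring of symmetric functions with `ω (p_λ) = (-1) ^ (n - ℓ) p_λ` for
every partition `λ` of `n` into `ℓ` parts (so `ℓ ≤ n`). -/
noncomputable def omega : symFun →ₗ[ℚ] symFun :=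
  powerSumBasis.constr ℚ fun l => (-1 : ℚ) ^ (l.1 - l.2.parts.card) • powerSumPart l

theorem omega_powerSumPart (l : Σ n : ℕ, n.Partition) :
    omega (powerSumPart l) = (-1 : ℚ) ^ (l.1 - l.2.parts.card) • powerSumPart l := by
  have h : powerSumBasis l = powerSumPart l := by simp [powerSumBasis]
  rw [← h, omega, Module.Basis.constr_basis, h]

/-! ### Colorings and the chromatic symmetric function -/

/-- The exponent of the monomial `x ^ κ = ∏ v, x_{κ v}` of a coloring `κ` by positive integers. -/
noncomputable def weight {V : Type*} [Fintype V] (κ : V → ℕ+) : ℕ+ →₀ ℕ :=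
  ∑ v, Finsupp.single (κ v) 1

theorem monomial_weight {V : Type*} [Fintype V] (κ : V → ℕ+) :
    MvPowerSeries.monomial (weight κ) (1 : ℚ) = ∏ v, MvPowerSeries.X (κ v) := by
  classical
  have h : ∀ t : Finset V, MvPowerSeries.monomial (∑ v ∈ t, Finsupp.single (κ v) 1) (1 : ℚ) =
      ∏ v ∈ t, MvPowerSeries.X (κ v) := by
    intro t
    induction t using Finset.induction_on with
    | empty => simp
    | insert v t hv ih =>
      rw [Finset.sum_insert hv, Finset.prod_insert hv, ← ih, MvPowerSeries.X_def,
        MvPowerSeries.monomial_mul_monomial, one_mul]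
  exact h Finset.univ

/-- Every monomial is the weight of finitely many colorings only. -/
theorem finite_weight_eq {V : Type*} [Fintype V] (d : ℕ+ →₀ ℕ) :
    {κ : V → ℕ+ | weight κ = d}.Finite := by
  classical
  refine (Set.Finite.pi' (fun _ : V => d.support.finite_toSet)).subset ?_
  rintro κ rfl v
  simp only [weight, Finset.mem_coe, Finsupp.mem_support_iff, Finsupp.finsetSum_apply]
  refine (Finset.sum_pos' (fun _ _ => Nat.zero_le _) ⟨v, Finset.mem_univ v, ?_⟩).ne'
  simp

/-- The chromatic symmetric function `X(G; x) = ∑ κ, x ^ κ`, the sum being over all proper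
colorings `κ` of `G` by positive integers. -/
noncomputable def chromaticSymFun {V : Type*} [Fintype V] (G : SimpleGraph V) : symFun :=
  ⟨formalSum fun κ : G.Coloring ℕ+ => weight κ, by
    refine formalSum_mem _ (Fintype.card V) (fun κ => ?_) fun e => ?_
    · simp [weight, map_sum]
    · refine ⟨⟨fun κ => SimpleGraph.Coloring.mk (fun v => e (κ v)) fun h =>
          e.injective.ne (κ.valid h),
        fun κ => SimpleGraph.Coloring.mk (fun v => e.symm (κ v)) fun h =>
          e.symm.injective.ne (κ.valid h), fun κ => ?_, fun κ => ?_⟩, fun κ => ?_⟩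
      · ext v; simp [SimpleGraph.Coloring.mk]
      · ext v; simp [SimpleGraph.Coloring.mk]
      · simp only [weight, Finsupp.mapDomain_finsetSum, Finsupp.mapDomain_single]
        rfl⟩

/-! ### Acyclic orientations -/

/-- `O` is an orientation of `G`: it arises by replacing every edge `uv` of `G` by exactly one of
the arcs `u → v` and `v → u`. -/
def IsOrientation {V : Type*} (O : Digraph V) (G : SimpleGraph V) : Prop :=
  (∀ u v, G.Adj u v ↔ O.Adj u v ∨ O.Adj v u) ∧ ∀ u v, O.Adj u v → ¬ O.Adj v u

/-- `O` is acyclic: no directed walk with at least one arc returns to its starting vertex. -/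
def IsAcyclic {V : Type*} (O : Digraph V) : Prop :=
  ∀ v, ¬ Relation.TransGen O.Adj v v

/-- `O` and `κ` are compatible: the colors weakly increase along every arc. -/
def Compatible {V : Type*} (O : Digraph V) (κ : V → ℕ+) : Prop :=
  ∀ u v, O.Adj u v → κ u ≤ κ v

/-- The set of the pairs `(O, κ)` of an acyclic orientation `O` of `G` and a coloring `κ` of `G` by
positive integers (not necessarily proper) that are compatible. -/
def compatiblePairs {V : Type*} (G : SimpleGraph V) : Set (Digraph V × (V → ℕ+)) :=
  {p | IsOrientation p.1 G ∧ IsAcyclic p.1 ∧ Compatible p.1 p.2}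

/-- Every monomial is the weight of finitely many compatible pairs only. -/
theorem finite_compatiblePairs_weight_eq {V : Type*} [Fintype V] (G : SimpleGraph V)
    (d : ℕ+ →₀ ℕ) : {p : compatiblePairs G | weight p.1.2 = d}.Finite := by
  classical
  have h : ((Set.univ : Set (Digraph V)) ×ˢ {κ : V → ℕ+ | weight κ = d}).Finite :=
    Set.finite_univ.prod (finite_weight_eq d)
  exact (h.preimage Subtype.val_injective.injOn).subset fun p hp => ⟨Set.mem_univ _, hp⟩

end ChromSym

/-!
Fix a monomial and compare its coefficients on the two sides. Both turn out to be sums over the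
colorings `κ` with that monomial, and the terms for a fixed `κ` depend only on the subgraph `G_κ`
formed by the edges of `G` that are monochromatic under `κ`.

On the right, an acyclic orientation of `G` compatible with `κ` is forced on the edges with two
colors and restricts to an arbitrary acyclic orientation of `G_κ` (`compatibleEquiv`), so `κ`
contributes the number `a(G_κ)` of acyclic orientations of `G_κ`.

On the left, inclusion–exclusion over the set of monochromatic edges gives
`X(G) = ∑ S ⊆ E, (-1) ^ |S| p_{λ(S)}`, where `λ(S)` lists the sizes of the components of the spanning
graph with edge set `S` (`chromaticSymFun_eq_sum`). The involution multiplies the term of `S` by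
`(-1) ^ (n - c(S))`, `c(S)` being the number of components, and `p_{λ(S)}` enumerates the colorings
that are constant on components, that is, with `S ⊆ E(G_κ)`. Hence `κ` contributes
`b(G_κ) = ∑ S ⊆ E(G_κ), (-1) ^ (|S| + n - c(S))`.

It remains to see that `a(H) = b(H)` for every graph `H` (`signedSum_edgeFinset`), which is Stanley's
theorem on acyclic orientations. For a set `U` of vertices let `H[U]` be the spanning graph of the
edges within `U`. Both functions take the value 1 on the edgeless graph and satisfy the recursion
`∑ T, (-1) ^ |T| f(H[U \ T]) = 0` for nonempty `U`, the sum being over the independent sets `T ⊆ U`,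
which determines `f(H[U])` by the values on smaller sets. For `a` this is inclusion–exclusion over
sets of sources (`sum_neg_one_pow_mul_card_acyclicOrientations`). For `b`, the independence of `T` is
written as a signed sum over the sets of edges within `T`; the double sum then runs over edge sets
`Q` and sets `T` that no edge of `Q` leaves, and for a fixed `Q` the signs cancel since such sets `T`
are arbitrary unions of components (`sum_neg_one_pow_mul_signedSum`).
-/

namespace ChromSym

open Finset

/-! ### Acyclic orientations, sources and colorings -/

/-- The set of the acyclic orientations of `G`. -/
def acyclicOrientations {V : Type*} (G : SimpleGraph V) : Set (Digraph V) :=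
  {O | IsOrientation O G ∧ IsAcyclic O}

/-- The spanning subgraph of `G` formed by the edges whose two ends have the same color. -/
def monochromatic {V : Type*} (G : SimpleGraph V) (κ : V → ℕ+) : SimpleGraph V where
  Adj u v := G.Adj u v ∧ κ u = κ v
  symm := ⟨fun _ _ h => ⟨h.1.symm, h.2.symm⟩⟩
  loopless := ⟨fun _ h => h.1.ne rfl⟩

/-- The spanning subgraph of `G` formed by the edges whose two ends lie in `U`; the vertices outside
`U` are kept, as isolated vertices. -/
def within {V : Type*} (G : SimpleGraph V) (U : Finset V) : SimpleGraph V where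
  Adj u v := G.Adj u v ∧ u ∈ U ∧ v ∈ U
  symm := ⟨fun _ _ h => ⟨h.1.symm, h.2.2, h.2.1⟩⟩
  loopless := ⟨fun _ h => h.1.ne rfl⟩

theorem Compatible.le_of_transGen {V : Type*} {O : Digraph V} {κ : V → ℕ+} (h : Compatible O κ)
    {u v : V} (huv : Relation.TransGen O.Adj u v) : κ u ≤ κ v := by
  induction huv with
  | single h1 => exact h _ _ h1
  | tail _ h1 ih => exact ih.trans (h _ _ h1)

/-- A directed walk of a compatible orientation that returns to its initial color is
monochromatic. -/
theorem Compatible.transGen_of_eq {V : Type*} {O : Digraph V} {κ : V → ℕ+} (h : Compatible O κ)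
    {u v : V} (huv : Relation.TransGen O.Adj u v) (hκ : κ u = κ v) :
    Relation.TransGen (fun a b => O.Adj a b ∧ κ a = κ b) u v := by
  induction huv with
  | single h1 => exact .single ⟨h1, hκ⟩
  | tail h0 h1 ih =>
    have h2 := h.le_of_transGen h0
    have h3 := h _ _ h1
    exact (ih (le_antisymm h2 (hκ ▸ h3))).tail ⟨h1, le_antisymm h3 (hκ ▸ h2)⟩

/-- An acyclic orientation compatible with `κ` is determined by its monochromatic arcs, since the
colors dictate the direction of the other edges, and the monochromatic edges may be oriented by any
acyclic orientation, since a directed cycle would be monochromatic. -/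
def compatibleEquiv {V : Type*} (G : SimpleGraph V) (κ : V → ℕ+) :
    {O : Digraph V // O ∈ acyclicOrientations G ∧ Compatible O κ} ≃
      acyclicOrientations (monochromatic G κ) where
  toFun O := ⟨⟨fun u v => O.1.Adj u v ∧ κ u = κ v⟩, by
    obtain ⟨O, ⟨⟨h1, h2⟩, h3⟩, h4⟩ := O
    refine ⟨⟨fun u v => ?_, fun u v h h' => h2 u v h.1 h'.1⟩, fun v hv => h3 v ?_⟩
    · change G.Adj u v ∧ κ u = κ v ↔ (O.Adj u v ∧ κ u = κ v) ∨ (O.Adj v u ∧ κ v = κ u)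
      rw [h1 u v, eq_comm (a := κ v), or_and_right]
    · exact Relation.TransGen.mono (fun _ _ h => h.1) _ _ hv⟩
  invFun O := ⟨⟨fun u v => O.1.Adj u v ∨ (G.Adj u v ∧ κ u < κ v)⟩, by
    obtain ⟨O, ⟨h1, h2⟩, h3⟩ := O
    have hO : ∀ u v, O.Adj u v → G.Adj u v ∧ κ u = κ v := fun u v h => (h1 u v).2 (.inl h)
    have hc : Compatible ⟨fun u v => O.Adj u v ∨ (G.Adj u v ∧ κ u < κ v)⟩ κ := by
      rintro u v (h | h)
      · exact (hO u v h).2.le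
      · exact h.2.le
    refine ⟨⟨⟨fun u v => ⟨fun h => ?_, ?_⟩, ?_⟩, fun v hv => h3 v ?_⟩, hc⟩
    · rcases lt_trichotomy (κ u) (κ v) with hlt | heq | hgt
      · exact .inl (.inr ⟨h, hlt⟩)
      · exact ((h1 u v).1 ⟨h, heq⟩).imp .inl .inl
      · exact .inr (.inr ⟨h.symm, hgt⟩)
    · rintro ((h | h) | (h | h))
      · exact (hO u v h).1
      · exact h.1
      · exact (hO v u h).1.symm
      · exact h.1.symm
    · rintro u v (h | h) (h' | h')
      · exact h2 u v h h'
      · exact h'.2.ne (hO u v h).2.symm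
      · exact h.2.ne (hO v u h').2.symm
      · exact lt_asymm h.2 h'.2
    · refine Relation.TransGen.mono ?_ _ _ (hc.transGen_of_eq hv rfl)
      rintro a b ⟨h | h, hab⟩
      · exact h
      · exact absurd hab h.2.ne⟩
  left_inv := by
    rintro ⟨O, ⟨⟨h1, h2⟩, h3⟩, h4⟩
    apply Subtype.ext
    ext u v
    change (O.Adj u v ∧ κ u = κ v) ∨ (G.Adj u v ∧ κ u < κ v) ↔ O.Adj u v
    constructor
    · rintro (h | h)
      · exact h.1
      · exact ((h1 u v).1 h.1).resolve_right fun h' => (h4 v u h').not_gt h.2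
    · intro h
      rcases (h4 u v h).eq_or_lt with heq | hlt
      · exact .inl ⟨h, heq⟩
      · exact .inr ⟨(h1 u v).2 (.inl h), hlt⟩
  right_inv := by
    rintro ⟨O, ⟨h1, h2⟩, h3⟩
    apply Subtype.ext
    ext u v
    change (O.Adj u v ∨ (G.Adj u v ∧ κ u < κ v)) ∧ κ u = κ v ↔ O.Adj u v
    constructor
    · rintro ⟨h | h, he⟩
      · exact h
      · exact absurd he h.2.ne
    · exact fun h => ⟨.inl h, ((h1 u v).2 (.inl h)).2⟩

theorem IsAcyclic.exists_source {V : Type*} [Finite V] {O : Digraph V} (h : IsAcyclic O)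
    {U : Finset V} (hU : U.Nonempty) : ∃ v ∈ U, ∀ u ∈ U, ¬ O.Adj u v := by
  have : Std.Irrefl (Relation.TransGen O.Adj) := ⟨h⟩
  obtain ⟨v, hv, hmin⟩ := (Finite.wellFounded_of_trans_of_irrefl
    (Relation.TransGen O.Adj)).has_min (U : Set V) hU
  exact ⟨v, hv, fun u hu huv => hmin u hu (.single huv)⟩

open Classical in
/-- Acyclic orientations of `G` within `U \ T`, for an independent set `T`, correspond to the acyclic
orientations within `U` for which every vertex of `T` is a source: give the vertices of `T` the
color 1 and the other ones the color 2. -/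
theorem card_acyclicOrientations_sdiff {V : Type*} (G : SimpleGraph V) {U T : Finset V}
    (hind : ∀ u ∈ T, ∀ v ∈ T, ¬ G.Adj u v) :
    Nat.card (acyclicOrientations (within G (U \ T))) =
      Nat.card {O : Digraph V // O ∈ acyclicOrientations (within G U) ∧
        ∀ v ∈ T, ∀ u, ¬ O.Adj u v} := by
  let κ : V → ℕ+ := fun v => if v ∈ T then 1 else 2
  have hm : monochromatic (within G U) κ = within G (U \ T) := by
    ext u v
    simp only [monochromatic, within, κ, mem_sdiff]
    by_cases hu : u ∈ T <;> by_cases hv : v ∈ T <;> simp [hu, hv]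
    exact fun h => absurd h (hind u hu v hv)
  rw [← hm, ← Nat.card_congr (compatibleEquiv (within G U) κ)]
  refine Nat.card_congr (Equiv.subtypeEquivRight fun O => and_congr_right fun hO => ?_)
  constructor
  · intro hc v hv u huv
    have hG := (hO.1.1 u v).2 (.inl huv)
    have hu : u ∉ T := fun hu => hind u hu v hv hG.1
    have := hc u v huv
    simp only [κ, hu, hv, if_true, if_false] at this
    exact absurd this (by decide)
  · intro h u v huv
    have hv : v ∉ T := fun hv => h v hv u huv
    simp only [κ, hv, if_false]
    split_ifs
    · decide
    · exact le_rfl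

open Classical in
/-- The recursion for the numbers of acyclic orientations: inclusion–exclusion over the sets of
sources, of which a nonempty acyclic digraph has at least one. -/
theorem sum_neg_one_pow_mul_card_acyclicOrientations {V : Type*} [Fintype V] (G : SimpleGraph V)
    {U : Finset V} (hU : U.Nonempty) :
    ∑ T ∈ U.powerset with ∀ u ∈ T, ∀ v ∈ T, ¬ G.Adj u v,
      (-1 : ℤ) ^ #T * Nat.card (acyclicOrientations (within G (U \ T))) = 0 := by
  let A : Finset (Digraph V) := {O | O ∈ acyclicOrientations (within G U)}
  have h1 : ∀ T ∈ U.powerset,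
      (if ∀ u ∈ T, ∀ v ∈ T, ¬ G.Adj u v then
        (-1 : ℤ) ^ #T * Nat.card (acyclicOrientations (within G (U \ T))) else 0) =
      ∑ O ∈ A, if ∀ v ∈ T, ∀ u, ¬ O.Adj u v then (-1 : ℤ) ^ #T else 0 := by
    intro T hT
    have hT := mem_powerset.mp hT
    rw [← sum_filter, sum_const, nsmul_eq_mul, mul_comm]
    split_ifs with hind
    · rw [card_acyclicOrientations_sdiff G hind, Nat.card_eq_fintype_card, Fintype.card_subtype,
        filter_filter]
    · push Not at hind
      obtain ⟨u, hu, v, hv, huv⟩ := hind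
      rw [filter_false_of_mem, card_empty, Nat.cast_zero, zero_mul]
      intro O hO hs
      rcases ((mem_filter.mp hO).2.1.1 u v).1 ⟨huv, hT hu, hT hv⟩ with h | h
      · exact hs v hv u h
      · exact hs u hu v h
  rw [sum_filter, sum_congr rfl h1, sum_comm]
  refine sum_eq_zero fun O hO => ?_
  have hO := (mem_filter.mp hO).2
  have hset : (U.powerset.filter fun T => ∀ v ∈ T, ∀ u, ¬ O.Adj u v) =
      (U.filter fun v => ∀ u, ¬ O.Adj u v).powerset := by
    ext T
    simp only [mem_filter, mem_powerset, subset_iff]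
    exact ⟨fun h v hv => ⟨h.1 hv, h.2 v hv⟩, fun h => ⟨fun v hv => (h hv).1, fun v hv => (h hv).2⟩⟩
  rw [← sum_filter, hset, sum_powerset_neg_one_pow_card_of_nonempty]
  obtain ⟨v, hv, hmin⟩ := hO.2.exists_source hU
  exact ⟨v, mem_filter.mpr ⟨hv, fun u huv => hmin u ((hO.1.1 u v).2 (.inl huv)).2.1 huv⟩⟩

theorem card_acyclicOrientations_bot {V : Type*} :
    Nat.card (acyclicOrientations (⊥ : SimpleGraph V)) = 1 := by
  have h : acyclicOrientations (⊥ : SimpleGraph V) = {⟨fun _ _ => False⟩} := by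
    ext O
    constructor
    · intro hO
      apply Digraph.ext
      ext u v
      exact iff_of_false (fun h => (hO.1.1 u v).2 (.inl h)) id
    · rintro rfl
      refine ⟨⟨fun u v => by simp, fun _ _ h => h.elim⟩, fun v hv => ?_⟩
      cases hv <;> assumption
  rw [h]
  simp

/-! ### Signed sums over edge sets -/

/-- The number of connected components of the spanning graph with edge set `S`. -/
noncomputable def numComponents {V : Type*} (S : Finset (Sym2 V)) : ℕ :=
  Nat.card (SimpleGraph.fromEdgeSet (S : Set (Sym2 V))).ConnectedComponent

open Classical in
/-- The elements of `E` whose two ends lie in `U`. -/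
noncomputable def edgesWithin {V : Type*} (E : Finset (Sym2 V)) (U : Finset V) :
    Finset (Sym2 V) :=
  E.filter fun e => ∀ v ∈ e, v ∈ U

theorem mem_edgesWithin {V : Type*} {E : Finset (Sym2 V)} {U : Finset V} {e : Sym2 V} :
    e ∈ edgesWithin E U ↔ e ∈ E ∧ ∀ v ∈ e, v ∈ U := by
  simp [edgesWithin]

theorem edgesWithin_subset {V : Type*} (E : Finset (Sym2 V)) (U : Finset V) :
    edgesWithin E U ⊆ E :=
  fun _ he => (mem_edgesWithin.mp he).1

theorem edgesWithin_mono {V : Type*} {E F : Finset (Sym2 V)} (h : E ⊆ F) (U : Finset V) :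
    edgesWithin E U ⊆ edgesWithin F U := fun _ he =>
  mem_edgesWithin.mpr ⟨h (mem_edgesWithin.mp he).1, (mem_edgesWithin.mp he).2⟩

/-- The sum `∑ S ⊆ E, (-1) ^ (|S| + n - c(S))`, where `n` is the number of vertices and `c(S)` the
number of components of the graph with edge set `S`. As `n - c(S)` and `n + c(S)` have the same
parity, the sum is written without a subtraction. -/
noncomputable def signedSum {V : Type*} [Fintype V] (E : Finset (Sym2 V)) : ℤ :=
  ∑ S ∈ E.powerset, (-1) ^ #S * (-1) ^ (Fintype.card V + numComponents S)

theorem card_connectedComponent_eq {V β : Type*} [Fintype V] [DecidableEq β] (G : SimpleGraph V)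
    (f : V → β) (h : ∀ u v, f u = f v ↔ G.Reachable u v) :
    Nat.card G.ConnectedComponent = #(univ.image f) := by
  let g : G.ConnectedComponent → {b // b ∈ univ.image f} :=
    Quot.lift (fun v => ⟨f v, mem_image_of_mem f (mem_univ v)⟩)
      fun u v huv => Subtype.ext ((h u v).2 huv)
  have hg : Function.Bijective g := by
    constructor
    · rintro ⟨u⟩ ⟨v⟩ huv
      exact SimpleGraph.ConnectedComponent.sound ((h u v).1 (congrArg Subtype.val huv))
    · rintro ⟨b, hb⟩
      obtain ⟨v, -, rfl⟩ := mem_image.mp hb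
      exact ⟨G.connectedComponentMk v, rfl⟩
  rw [Nat.card_eq_of_bijective g hg, Nat.card_eq_fintype_card, Fintype.card_coe]

open Classical in
/-- If no edge of `S` leaves `W`, then the edges within `W` form the components of `S` that lie in
`W`, and the other vertices become isolated. -/
theorem numComponents_edgesWithin {V : Type*} [Fintype V] (S : Finset (Sym2 V)) (W : Finset V)
    (hW : ∀ u v, s(u, v) ∈ S → u ∈ W → v ∈ W) :
    numComponents (edgesWithin S W) =
      #(W.image (SimpleGraph.fromEdgeSet (S : Set (Sym2 V))).connectedComponentMk) + #Wᶜ := by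
  set mk := (SimpleGraph.fromEdgeSet (S : Set (Sym2 V))).connectedComponentMk with hmk
  let f : V → _ ⊕ V := fun v => if v ∈ W then Sum.inl (mk v) else Sum.inr v
  rw [numComponents, card_connectedComponent_eq _ f, ← card_disjSum]
  · congr 1
    ext x
    simp only [mem_image, mem_univ, true_and, mem_disjSum, mem_compl, f]
    constructor
    · rintro ⟨v, rfl⟩
      by_cases hv : v ∈ W
      · exact .inl ⟨mk v, ⟨v, hv, rfl⟩, by simp [hv]⟩
      · exact .inr ⟨v, hv, by simp [hv]⟩
    · rintro (⟨_, ⟨v, hv, rfl⟩, rfl⟩ | ⟨v, hv, rfl⟩) <;> exact ⟨v, by simp [hv]⟩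
  · have hback : ∀ u v, (SimpleGraph.fromEdgeSet (S : Set (Sym2 V))).Reachable u v → u ∈ W →
        (SimpleGraph.fromEdgeSet (edgesWithin S W : Set (Sym2 V))).Reachable u v := by
      rintro u v ⟨p⟩
      induction p with
      | nil => exact fun _ => .refl _
      | cons hadj _ ih =>
        intro hu
        rw [SimpleGraph.fromEdgeSet_adj, mem_coe] at hadj
        have hv := hW _ _ hadj.1 hu
        refine SimpleGraph.Reachable.trans (SimpleGraph.Adj.reachable ?_) (ih hv)
        rw [SimpleGraph.fromEdgeSet_adj, mem_coe, mem_edgesWithin]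
        exact ⟨⟨hadj.1, by simp [hu, hv]⟩, hadj.2⟩
    intro u v
    constructor
    · intro h
      by_cases hu : u ∈ W <;> by_cases hv : v ∈ W <;> simp only [f, hu, hv, if_true, if_false,
        Sum.inl.injEq, Sum.inr.injEq, reduceCtorEq] at h
      · exact hback u v (SimpleGraph.ConnectedComponent.exact h) hu
      · rw [h]
    · rintro ⟨p⟩
      induction p with
      | nil => rfl
      | cons hadj _ ih =>
        rw [← ih]
        rw [SimpleGraph.fromEdgeSet_adj, mem_coe, mem_edgesWithin] at hadj
        obtain ⟨⟨h1, h2⟩, h3⟩ := hadj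
        have hm : ∀ a b, s(a, b) ∈ S → a ≠ b → mk a = mk b := fun a b h h' =>
          SimpleGraph.ConnectedComponent.sound (SimpleGraph.Adj.reachable
            ((SimpleGraph.fromEdgeSet_adj _).2 ⟨h, h'⟩))
        simp only [Sym2.mem_iff, forall_eq_or_imp, forall_eq] at h2
        simp only [f, h2.1, h2.2, if_true, hm _ _ h1 h3]

open Classical in
/-- The sets of vertices that no edge of `Q` leaves are the unions of components of `Q`, so their
signed count, by the number of components in the complement, vanishes. -/
theorem sum_closed_eq_zero {V : Type*} [Fintype V] (Q : Finset (Sym2 V)) {U : Finset V}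
    (hU : U.Nonempty) (hQ : edgesWithin Q U = Q) :
    ∑ T ∈ U.powerset with Q = edgesWithin Q T ∪ edgesWithin Q (U \ T),
      (-1 : ℤ) ^ #T *
        (-1) ^ (Fintype.card V + numComponents (edgesWithin Q (U \ T))) = 0 := by
  set G := SimpleGraph.fromEdgeSet (Q : Set (Sym2 V)) with hG
  have hQU : ∀ u v, s(u, v) ∈ Q → u ∈ U ∧ v ∈ U := by
    intro u v h
    rw [← hQ, mem_edgesWithin] at h
    exact ⟨h.2 u (by simp), h.2 v (by simp)⟩
  have hcl : ∀ T ⊆ U, Q = edgesWithin Q T ∪ edgesWithin Q (U \ T) →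
      ∀ u v, s(u, v) ∈ Q → u ∈ U \ T → v ∈ U \ T := by
    intro T hT h u v huv hu
    rw [h, mem_union, mem_edgesWithin, mem_edgesWithin] at huv
    rcases huv with huv | huv
    · exact absurd (huv.2 u (by simp)) (mem_sdiff.mp hu).2
    · exact huv.2 v (by simp)
  have hreach : ∀ W : Finset V, (∀ u v, s(u, v) ∈ Q → u ∈ W → v ∈ W) →
      ∀ u v, G.connectedComponentMk u = G.connectedComponentMk v → u ∈ W → v ∈ W := by
    intro W hW u v huv
    obtain ⟨p⟩ := SimpleGraph.ConnectedComponent.exact huv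
    clear huv
    induction p with
    | nil => exact id
    | cons hadj _ ih => exact fun hu => ih (hW _ _ ((SimpleGraph.fromEdgeSet_adj _).1 hadj).1 hu)
  have hsum : ∑ A ∈ (U.image G.connectedComponentMk).powerset,
      (-1 : ℤ) ^ #U * (-1 : ℤ) ^ #A = 0 := by
    rw [← mul_sum, sum_powerset_neg_one_pow_card_of_nonempty (hU.image _), mul_zero]
  rw [← hsum]
  -- `T` corresponds to the set `A` of the components in `U` that avoid it
  refine sum_nbij' (fun T => (U \ T).image G.connectedComponentMk)
    (fun A => U.filter fun v => G.connectedComponentMk v ∉ A) ?_ ?_ ?_ ?_ ?_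
  · intro T _
    exact mem_powerset.mpr (image_subset_image sdiff_subset)
  · intro A _
    refine mem_filter.mpr ⟨mem_powerset.mpr (filter_subset _ _), ?_⟩
    refine Subset.antisymm ?_ (union_subset (edgesWithin_subset _ _) (edgesWithin_subset _ _))
    intro e
    induction e using Sym2.ind with
    | _ u v =>
    intro he
    obtain ⟨hu, hv⟩ := hQU u v he
    have huv : G.connectedComponentMk u = G.connectedComponentMk v := by
      by_cases h : u = v
      · rw [h]
      · exact SimpleGraph.ConnectedComponent.sound (SimpleGraph.Adj.reachable
            ((SimpleGraph.fromEdgeSet_adj _).2 ⟨he, h⟩))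
    by_cases hA : G.connectedComponentMk v ∈ A <;>
      simp [mem_edgesWithin, he, hu, hv, huv, hA]
  · intro T hT
    obtain ⟨hTU, hTQ⟩ := mem_filter.mp hT
    have hTU := mem_powerset.mp hTU
    ext v
    simp only [mem_filter, mem_image, not_exists, not_and]
    constructor
    · rintro ⟨hv, h⟩
      by_contra hvT
      exact h v (mem_sdiff.mpr ⟨hv, hvT⟩) rfl
    · intro hv
      refine ⟨hTU hv, fun u hu huv => ?_⟩
      exact (mem_sdiff.mp (hreach _ (hcl T hTU hTQ) u v huv hu)).2 hv
  · intro A hA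
    ext c
    simp only [mem_image, mem_sdiff, mem_filter, not_and, not_not]
    constructor
    · rintro ⟨v, ⟨hv, h⟩, rfl⟩
      exact h hv
    · intro hc
      obtain ⟨v, hv, rfl⟩ := mem_image.mp (mem_powerset.mp hA hc)
      exact ⟨v, ⟨hv, fun _ => hc⟩, rfl⟩
  · intro T hT
    obtain ⟨hTU, hTQ⟩ := mem_filter.mp hT
    have hTU := mem_powerset.mp hTU
    rw [numComponents_edgesWithin Q (U \ T) (hcl T hTU hTQ), ← pow_add, ← pow_add, card_compl]
    -- both exponents have the same parity, because `#(U \ T) = #U - #T`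
    have h1 := card_sdiff_add_card_eq_card hTU
    have h2 := card_le_univ (U \ T)
    rw [← hG, neg_one_pow_congr]
    simp only [Nat.even_iff]
    omega

open Classical in
/-- The signed sums satisfy the recursion of the numbers of acyclic orientations. -/
theorem sum_neg_one_pow_mul_signedSum {V : Type*} [Fintype V] (E : Finset (Sym2 V))
    {U : Finset V} (hU : U.Nonempty) :
    ∑ T ∈ U.powerset with edgesWithin E T = ∅,
      (-1 : ℤ) ^ #T * signedSum (edgesWithin E (U \ T)) = 0 := by
  have h1 : ∀ T ∈ U.powerset,
      (if edgesWithin E T = ∅ then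
        (-1 : ℤ) ^ #T * signedSum (edgesWithin E (U \ T)) else 0) =
      ∑ Q ∈ (edgesWithin E U).powerset,
        if Q = edgesWithin Q T ∪ edgesWithin Q (U \ T) then (-1 : ℤ) ^ #Q * ((-1 : ℤ) ^ #T *
          (-1) ^ (Fintype.card V + numComponents (edgesWithin Q (U \ T)))) else 0 := by
    intro T hT
    have hT := mem_powerset.mp hT
    have h2 : (if edgesWithin E T = ∅ then
        (-1 : ℤ) ^ #T * signedSum (edgesWithin E (U \ T)) else 0) =
        (∑ R ∈ (edgesWithin E T).powerset, (-1 : ℤ) ^ #R) *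
          ((-1 : ℤ) ^ #T * signedSum (edgesWithin E (U \ T))) := by
      rw [sum_powerset_neg_one_pow_card]
      split_ifs <;> simp
    rw [h2, signedSum, mul_sum, sum_mul_sum, ← sum_product', ← sum_filter]
    -- a pair `e` has an element, so it cannot lie within both of `T` and `U \ T`
    have hno : ∀ e : Sym2 V, (∀ v ∈ e, v ∈ T) → ¬ ∀ v ∈ e, v ∈ U \ T := fun e h h' =>
      (mem_sdiff.mp (h' _ e.out_fst_mem)).2 (h _ e.out_fst_mem)
    have key : ∀ R ⊆ edgesWithin E T, ∀ S ⊆ edgesWithin E (U \ T),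
        edgesWithin (R ∪ S) T = R ∧ edgesWithin (R ∪ S) (U \ T) = S := by
      intro R hR S hS
      constructor
      · ext e
        simp only [mem_edgesWithin, mem_union]
        constructor
        · rintro ⟨h | h, h'⟩
          · exact h
          · exact absurd (mem_edgesWithin.mp (hS h)).2 (hno e h')
        · exact fun h => ⟨.inl h, (mem_edgesWithin.mp (hR h)).2⟩
      · ext e
        simp only [mem_edgesWithin, mem_union]
        constructor
        · rintro ⟨h | h, h'⟩
          · exact absurd h' (hno e (mem_edgesWithin.mp (hR h)).2)
          · exact h
        · exact fun h => ⟨.inr h, (mem_edgesWithin.mp (hS h)).2⟩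
    refine sum_nbij' (fun p => p.1 ∪ p.2) (fun Q => (edgesWithin Q T, edgesWithin Q (U \ T)))
      ?_ ?_ ?_ ?_ ?_
    · rintro ⟨R, S⟩ h
      obtain ⟨hR, hS⟩ := mem_product.mp h
      have hR := mem_powerset.mp hR
      have hS := mem_powerset.mp hS
      obtain ⟨k1, k2⟩ := key R hR S hS
      refine mem_filter.mpr ⟨mem_powerset.mpr (union_subset ?_ ?_), by rw [k1, k2]⟩
      · intro e he
        have := mem_edgesWithin.mp (hR he)
        exact mem_edgesWithin.mpr ⟨this.1, fun v hv => hT (this.2 v hv)⟩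
      · intro e he
        have := mem_edgesWithin.mp (hS he)
        exact mem_edgesWithin.mpr ⟨this.1, fun v hv => (mem_sdiff.mp (this.2 v hv)).1⟩
    · intro Q hQ
      have hQ := mem_powerset.mp (mem_filter.mp hQ).1
      have hE : Q ⊆ E := hQ.trans (edgesWithin_subset _ _)
      exact mem_product.mpr ⟨mem_powerset.mpr (edgesWithin_mono hE _),
        mem_powerset.mpr (edgesWithin_mono hE _)⟩
    · rintro ⟨R, S⟩ h
      obtain ⟨hR, hS⟩ := mem_product.mp h
      obtain ⟨k1, k2⟩ := key R (mem_powerset.mp hR) S (mem_powerset.mp hS)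
      exact Prod.ext k1 k2
    · intro Q hQ
      exact (mem_filter.mp hQ).2.symm
    · rintro ⟨R, S⟩ h
      obtain ⟨hR, hS⟩ := mem_product.mp h
      have hR := mem_powerset.mp hR
      have hS := mem_powerset.mp hS
      obtain ⟨-, k2⟩ := key R hR S hS
      have hd : Disjoint R S := Finset.disjoint_left.mpr fun e h1 h2 =>
        hno e (mem_edgesWithin.mp (hR h1)).2 (mem_edgesWithin.mp (hS h2)).2
      simp only [k2, card_union_of_disjoint hd]
      ring
  rw [sum_filter, sum_congr rfl h1, sum_comm]
  refine sum_eq_zero fun Q hQ => ?_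
  have hQ := mem_powerset.mp hQ
  rw [← sum_filter, ← mul_sum, sum_closed_eq_zero Q hU, mul_zero]
  exact (edgesWithin_subset _ _).antisymm fun e he =>
    mem_edgesWithin.mpr ⟨he, (mem_edgesWithin.mp (hQ he)).2⟩

theorem signedSum_empty {V : Type*} [Fintype V] : signedSum (∅ : Finset (Sym2 V)) = 1 := by
  classical
  have h : numComponents (∅ : Finset (Sym2 V)) = Fintype.card V := by
    rw [numComponents, card_connectedComponent_eq _ (id : V → V)]
    · simp
    · intro u v
      simp [SimpleGraph.reachable_bot]
  simp [signedSum, h]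

/-! ### The recursion determines the number of acyclic orientations -/

open Classical in
theorem edgeFinset_within {V : Type*} [Fintype V] (G : SimpleGraph V) (U : Finset V) :
    (within G U).edgeFinset = edgesWithin G.edgeFinset U := by
  ext e
  induction e using Sym2.ind with
  | _ u v =>
    rw [SimpleGraph.mem_edgeFinset, SimpleGraph.mem_edgeSet, mem_edgesWithin]
    simp [within]

open Classical in
/-- Stanley's theorem that the number of acyclic orientations of a graph with `n` vertices and
chromatic polynomial `χ` is `(-1) ^ n χ(-1)`, for Whitney's expansion of `χ` over edge sets. -/
theorem signedSum_edgeFinset {V : Type*} [Fintype V] (G : SimpleGraph V) :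
    signedSum G.edgeFinset = Nat.card (acyclicOrientations G) := by
  have hrec : ∀ U : Finset V, signedSum (edgesWithin G.edgeFinset U) =
      Nat.card (acyclicOrientations (within G U)) := by
    intro U
    induction U using Finset.strongInduction with
    | H U ih =>
    rcases U.eq_empty_or_nonempty with rfl | hU
    · have h1 : edgesWithin G.edgeFinset (∅ : Finset V) = ∅ :=
        eq_empty_of_forall_notMem fun e he =>
          absurd ((mem_edgesWithin.mp he).2 _ e.out_fst_mem) (notMem_empty _)
      have h2 : within G ∅ = ⊥ := by
        ext u v
        simp [within]
      rw [h1, h2, signedSum_empty, card_acyclicOrientations_bot, Nat.cast_one]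
    · have h1 := sum_neg_one_pow_mul_signedSum G.edgeFinset hU
      have h2 := sum_neg_one_pow_mul_card_acyclicOrientations G hU
      have hf : ∀ T : Finset V, edgesWithin G.edgeFinset T = ∅ ↔
          ∀ u ∈ T, ∀ v ∈ T, ¬ G.Adj u v := by
        intro T
        rw [eq_empty_iff_forall_notMem]
        constructor
        · intro h u hu v hv huv
          exact h s(u, v) (mem_edgesWithin.mpr ⟨by simpa using huv, by simp [hu, hv]⟩)
        · intro h e
          induction e using Sym2.ind with
          | _ u v =>
            intro he
            have := mem_edgesWithin.mp he
            exact h u (this.2 u (by simp)) v (this.2 v (by simp)) (by simpa using this.1)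
      simp only [hf] at h1
      rw [← h2] at h1
      have hmem : ∅ ∈ U.powerset.filter fun T => ∀ u ∈ T, ∀ v ∈ T, ¬ G.Adj u v := by simp
      rw [← add_sum_erase _ _ hmem, ← add_sum_erase _ _ hmem] at h1
      have hrest : ∀ T ∈ (U.powerset.filter fun T => ∀ u ∈ T, ∀ v ∈ T, ¬ G.Adj u v).erase ∅,
          (-1 : ℤ) ^ #T * signedSum (edgesWithin G.edgeFinset (U \ T)) =
            (-1 : ℤ) ^ #T * Nat.card (acyclicOrientations (within G (U \ T))) := by
        intro T hT
        obtain ⟨hne, hT⟩ := mem_erase.mp hT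
        have hTU := mem_powerset.mp (mem_filter.mp hT).1
        rw [ih _ (sdiff_ssubset hTU (nonempty_iff_ne_empty.mpr hne))]
      rw [sum_congr rfl hrest] at h1
      simpa using add_right_cancel h1
  have huniv := hrec univ
  have hG : within G univ = G := by
    ext u v
    simp [within]
  rw [← edgeFinset_within] at huniv
  convert huniv
  · exact hG.symm
  · exact hG.symm

/-! ### Expansion of the chromatic symmetric function in power sums -/

/-- A product of formal sums is the formal sum over the product of the index sets. -/
theorem prod_formalSum {ι : Type*} [Fintype ι] {J : ι → Type*} (w : ∀ c, J c → (ℕ+ →₀ ℕ))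
    (hfin : ∀ c d, Finite {j // w c j = d}) :
    ∏ c, formalSum (w c) = formalSum fun g : ∀ c, J c => ∑ c, w c (g c) := by
  classical
  ext d
  rw [MvPowerSeries.coeff_prod, coeff_formalSum]
  simp only [coeff_formalSum]
  let ψ : (Σ l : {l // l ∈ finsuppAntidiag (univ : Finset ι) d}, ∀ c, {j // w c j = l.1 c}) →
      {g : ∀ c, J c // ∑ c, w c (g c) = d} := fun x => ⟨fun c => (x.2 c).1, by
    exact (sum_congr rfl fun c _ => (x.2 c).2).trans (mem_finsuppAntidiag.mp x.1.2).1⟩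
  have hψ : Function.Bijective ψ := by
    constructor
    · rintro ⟨⟨l, hl⟩, h⟩ ⟨⟨l', hl'⟩, h'⟩ heq
      have hc : ∀ c, (h c).1 = (h' c).1 := fun c => congrFun (congrArg Subtype.val heq) c
      obtain rfl : l = l' := Finsupp.ext fun c =>
        (h c).2.symm.trans ((congrArg (w c) (hc c)).trans (h' c).2)
      congr 1
      exact funext fun c => Subtype.ext (hc c)
    · rintro ⟨g, rfl⟩
      exact ⟨⟨⟨Finsupp.equivFunOnFinite.symm fun c => w c (g c), by
        simp [mem_finsuppAntidiag]⟩, fun c => ⟨g c, rfl⟩⟩, rfl⟩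
  rw [← Nat.card_eq_of_bijective ψ hψ, Nat.card_sigma]
  simp only [Nat.card_pi]
  rw [sum_coe_sort (finsuppAntidiag (univ : Finset ι) d)
    (fun l => ∏ c, Nat.card {j // w c j = l c})]
  push_cast
  rfl

open Classical in
/-- The partition of `|V|` formed by the sizes of the fibers of a surjection on `V`. -/
noncomputable def fiberPartition {V ι : Type*} [Fintype V] [Fintype ι] (f : V → ι)
    (hf : Function.Surjective f) : Σ n : ℕ, n.Partition :=
  ⟨Fintype.card V, ⟨(univ : Finset ι).val.map fun c => #{v | f v = c}, by
    intro k hk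
    obtain ⟨c, -, rfl⟩ := Multiset.mem_map.mp hk
    obtain ⟨v, rfl⟩ := hf c
    exact card_pos.mpr ⟨v, by simp⟩, by
    rw [← card_univ, card_eq_sum_card_fiberwise (f := f) (t := univ) (by simp [Set.MapsTo])]
    rfl⟩⟩

theorem card_parts_fiberPartition {V ι : Type*} [Fintype V] [Fintype ι] (f : V → ι)
    (hf : Function.Surjective f) : (fiberPartition f hf).2.parts.card = Nat.card ι := by
  simp [fiberPartition]

/-- The power sum of the fiber sizes of `f` enumerates the colorings that are constant on the
fibers of `f`. -/
theorem powerSumPart_fiberPartition {V ι : Type*} [Fintype V] [Fintype ι] (f : V → ι)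
    (hf : Function.Surjective f) :
    (powerSumPart (fiberPartition f hf) : MvPowerSeries ℕ+ ℚ) =
      formalSum fun g : ι → ℕ+ => weight (g ∘ f) := by
  classical
  have h1 : powerSumPart (fiberPartition f hf) = ∏ c, powerSum #{v | f v = c} := by
    simp only [powerSumPart, fiberPartition, Multiset.map_map]
    congr
  have h2 : ∀ g : ι → ℕ+, weight (g ∘ f) = ∑ c, Finsupp.single (g c) #{v | f v = c} := by
    intro g
    rw [weight, ← sum_fiberwise (s := univ) (g := f)]
    refine sum_congr rfl fun c _ => ?_
    rw [sum_congr rfl (g := fun _ => Finsupp.single (g c) 1)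
      fun v hv => by rw [Function.comp_apply, (mem_filter.mp hv).2], sum_const,
      Finsupp.smul_single, smul_eq_mul, mul_one]
  rw [h1, SubmonoidClass.coe_finsetProd]
  simp only [h2]
  refine prod_formalSum (fun c (i : ℕ+) => Finsupp.single i #{v | f v = c}) fun c d => ?_
  have hc : #{v | f v = c} ≠ 0 := by
    obtain ⟨v, rfl⟩ := hf c
    exact (card_pos.mpr ⟨v, by simp⟩).ne'
  have : Subsingleton {i : ℕ+ // Finsupp.single i #{v | f v = c} = d} :=
    ⟨fun a b => Subtype.ext (Finsupp.single_left_injective hc (a.2.trans b.2.symm))⟩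
  infer_instance

theorem surjective_connectedComponentMk {V : Type*} (G : SimpleGraph V) :
    Function.Surjective G.connectedComponentMk :=
  fun c => c.exists_rep

open Classical in
/-- The partition of `|V|` formed by the sizes of the components of the spanning graph with edge
set `S`. -/
noncomputable def componentPartition {V : Type*} [Fintype V] (S : Finset (Sym2 V)) :
    Σ n : ℕ, n.Partition :=
  fiberPartition (SimpleGraph.fromEdgeSet (S : Set (Sym2 V))).connectedComponentMk
    (surjective_connectedComponentMk _)

theorem card_parts_componentPartition {V : Type*} [Fintype V] (S : Finset (Sym2 V)) :
    (componentPartition S).2.parts.card = numComponents S := by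
  classical
  exact card_parts_fiberPartition _ _

/-- The finite set of the colorings of weight `d`. -/
noncomputable def coloringsOfWeight (V : Type*) [Fintype V] (d : ℕ+ →₀ ℕ) :
    Finset (V → ℕ+) :=
  (finite_weight_eq d).toFinset

theorem mem_coloringsOfWeight {V : Type*} [Fintype V] {d : ℕ+ →₀ ℕ} {κ : V → ℕ+} :
    κ ∈ coloringsOfWeight V d ↔ weight κ = d := by
  simp [coloringsOfWeight]

open Classical in
theorem coeff_powerSumPart_componentPartition {V : Type*} [Fintype V] (G : SimpleGraph V)
    {S : Finset (Sym2 V)} (hS : S ⊆ G.edgeFinset) (d : ℕ+ →₀ ℕ) :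
    MvPowerSeries.coeff d (powerSumPart (componentPartition S)).1 =
      #{κ ∈ coloringsOfWeight V d | S ⊆ (monochromatic G κ).edgeFinset} := by
  rw [componentPartition, powerSumPart_fiberPartition, coeff_formalSum, Nat.cast_inj]
  set H := SimpleGraph.fromEdgeSet (S : Set (Sym2 V)) with hH
  rw [← Fintype.card_coe, ← Nat.card_eq_fintype_card]
  have hmem : ∀ {u v}, s(u, v) ∈ S → G.Adj u v := fun h => by simpa using hS h
  have hpos : ∀ g : H.ConnectedComponent → ℕ+,
      S ⊆ (monochromatic G (g ∘ H.connectedComponentMk)).edgeFinset := by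
    intro g e
    induction e using Sym2.ind with
    | _ u v =>
      intro he
      rw [SimpleGraph.mem_edgeFinset, SimpleGraph.mem_edgeSet]
      refine ⟨hmem he, congrArg g (SimpleGraph.ConnectedComponent.sound
        (SimpleGraph.Adj.reachable ((SimpleGraph.fromEdgeSet_adj _).2 ⟨he, (hmem he).ne⟩)))⟩
  refine Nat.card_eq_of_bijective (fun g => ⟨g.1 ∘ H.connectedComponentMk,
    mem_filter.mpr ⟨mem_coloringsOfWeight.mpr g.2, hpos g.1⟩⟩) ⟨?_, ?_⟩
  · rintro ⟨g, hg⟩ ⟨g', hg'⟩ h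
    have h := congrArg Subtype.val h
    refine Subtype.ext (funext fun c => ?_)
    obtain ⟨v, rfl⟩ := c.exists_rep
    exact congrFun h v
  · rintro ⟨κ, hκ⟩
    obtain ⟨hw, hm⟩ := mem_filter.mp hκ
    have hadj : ∀ u v, H.Reachable u v → κ u = κ v := by
      rintro u v ⟨p⟩
      induction p with
      | nil => rfl
      | cons h _ ih =>
        have := hm ((SimpleGraph.fromEdgeSet_adj _).1 h).1
        rw [SimpleGraph.mem_edgeFinset, SimpleGraph.mem_edgeSet] at this
        exact this.2.trans ih
    exact ⟨⟨Quot.lift κ hadj, mem_coloringsOfWeight.mp hw⟩, rfl⟩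

open Classical in
theorem filter_powerset_edgeFinset {V : Type*} [Fintype V] (G : SimpleGraph V) (κ : V → ℕ+) :
    (G.edgeFinset.powerset.filter fun S => S ⊆ (monochromatic G κ).edgeFinset) =
      (monochromatic G κ).edgeFinset.powerset := by
  ext S
  rw [mem_filter, mem_powerset, mem_powerset, and_iff_right_iff_imp]
  exact fun h => h.trans (SimpleGraph.edgeFinset_mono fun _ _ h => h.1)

open Classical in
theorem coeff_chromaticSymFun {V : Type*} [Fintype V] (G : SimpleGraph V) (d : ℕ+ →₀ ℕ) :
    MvPowerSeries.coeff d (chromaticSymFun G).1 =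
      #{κ ∈ coloringsOfWeight V d | (monochromatic G κ).edgeFinset = ∅} := by
  change MvPowerSeries.coeff d (formalSum _) = _
  rw [coeff_formalSum, Nat.cast_inj, ← Fintype.card_coe, ← Nat.card_eq_fintype_card]
  have hmono : ∀ κ : V → ℕ+, (monochromatic G κ).edgeFinset = ∅ ↔
      ∀ u v, G.Adj u v → κ u ≠ κ v := by
    intro κ
    rw [SimpleGraph.edgeFinset_eq_empty]
    constructor
    · intro h u v huv hκ
      have : (monochromatic G κ).Adj u v := ⟨huv, hκ⟩
      rw [h] at this
      exact this
    · intro h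
      ext u v
      exact iff_of_false (fun h' => h u v h'.1 h'.2) id
  refine Nat.card_eq_of_bijective (fun κ => ⟨κ.1, mem_filter.mpr
    ⟨mem_coloringsOfWeight.mpr κ.2, (hmono _).2 fun u v h => κ.1.valid h⟩⟩) ⟨?_, ?_⟩
  · rintro ⟨κ, hκ⟩ ⟨κ', hκ'⟩ h
    have h := congrArg Subtype.val h
    exact Subtype.ext (DFunLike.coe_injective h)
  · rintro ⟨κ, hκ⟩
    obtain ⟨hw, hm⟩ := mem_filter.mp hκ
    exact ⟨⟨SimpleGraph.Coloring.mk κ fun {u v} h => (hmono κ).1 hm u v h,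
      mem_coloringsOfWeight.mp hw⟩, rfl⟩

open Classical in
/-- Stanley's expansion of the chromatic symmetric function in power sums, by inclusion–exclusion
over the set of monochromatic edges. -/
theorem chromaticSymFun_eq_sum {V : Type*} [Fintype V] (G : SimpleGraph V) :
    chromaticSymFun G =
      ∑ S ∈ G.edgeFinset.powerset, (-1 : ℚ) ^ #S • powerSumPart (componentPartition S) := by
  apply Subtype.ext
  ext d
  rw [coeff_coe_sum, coeff_chromaticSymFun, card_filter]
  push_cast
  have h : ∀ S ∈ G.edgeFinset.powerset,
      (-1 : ℚ) ^ #S * MvPowerSeries.coeff d (powerSumPart (componentPartition S)).1 =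
      ∑ κ ∈ coloringsOfWeight V d,
        if S ⊆ (monochromatic G κ).edgeFinset then (-1 : ℚ) ^ #S else 0 := by
    intro S hS
    rw [coeff_powerSumPart_componentPartition G (mem_powerset.mp hS), ← sum_filter, sum_const,
      nsmul_eq_mul, mul_comm]
  rw [sum_congr rfl h, sum_comm]
  refine sum_congr rfl fun κ _ => ?_
  rw [← sum_filter, filter_powerset_edgeFinset]
  exact_mod_cast (sum_powerset_neg_one_pow_card (x := (monochromatic G κ).edgeFinset)).symm

/-- Fixing the coloring, the compatible acyclic orientations are counted by those of the
monochromatic subgraph. -/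
theorem coeff_compatiblePairs {V : Type*} [Fintype V] (G : SimpleGraph V) (d : ℕ+ →₀ ℕ) :
    MvPowerSeries.coeff d (formalSum fun p : compatiblePairs G => weight p.1.2) =
      ∑ κ ∈ coloringsOfWeight V d, (Nat.card (acyclicOrientations (monochromatic G κ)) : ℚ) := by
  classical
  rw [coeff_formalSum, ← Nat.cast_sum, Nat.cast_inj, ← sum_coe_sort]
  have : ∀ κ : V → ℕ+, Nat.card (acyclicOrientations (monochromatic G κ)) =
      Nat.card {O : Digraph V // O ∈ acyclicOrientations G ∧ Compatible O κ} :=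
    fun κ => (Nat.card_congr (compatibleEquiv G κ)).symm
  simp only [this]
  rw [← Nat.card_sigma]
  exact Nat.card_congr
    { toFun := fun p => ⟨⟨p.1.1.2, mem_coloringsOfWeight.mpr p.2⟩,
        ⟨p.1.1.1, ⟨p.1.2.1, p.1.2.2.1⟩, p.1.2.2.2⟩⟩
      invFun := fun x => ⟨⟨(x.2.1, x.1.1), x.2.2.1.1, x.2.2.1.2, x.2.2.2⟩,
        mem_coloringsOfWeight.mp x.1.2⟩
      left_inv := fun _ => rfl
      right_inv := fun _ => rfl }

theorem numComponents_le {V : Type*} [Fintype V] (S : Finset (Sym2 V)) :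
    numComponents S ≤ Fintype.card V := by
  rw [← Nat.card_eq_fintype_card]
  exact Nat.card_le_card_of_surjective _ (surjective_connectedComponentMk _)

open Classical in
/-- Applying `ω` to the expansion in power sums introduces the signs `(-1) ^ (n - c(S))`. -/
theorem coeff_omega_chromaticSymFun {V : Type*} [Fintype V] (G : SimpleGraph V) (d : ℕ+ →₀ ℕ) :
    MvPowerSeries.coeff d (omega (chromaticSymFun G)).1 =
      ∑ κ ∈ coloringsOfWeight V d, (signedSum (monochromatic G κ).edgeFinset : ℚ) := by
  have h1 : omega (chromaticSymFun G) = ∑ S ∈ G.edgeFinset.powerset,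
      ((-1 : ℚ) ^ #S * (-1) ^ (Fintype.card V + numComponents S)) •
        powerSumPart (componentPartition S) := by
    rw [chromaticSymFun_eq_sum, map_sum]
    refine sum_congr rfl fun S _ => ?_
    rw [map_smul, omega_powerSumPart, smul_smul, card_parts_componentPartition]
    have hn : (componentPartition S).1 = Fintype.card V := rfl
    have hle := numComponents_le S
    have hpar : (-1 : ℚ) ^ (Fintype.card V - numComponents S) =
        (-1) ^ (Fintype.card V + numComponents S) := by
      rw [neg_one_pow_congr]
      simp only [Nat.even_iff]
      omega
    rw [hn, hpar]
  rw [h1, coeff_coe_sum]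
  have h2 : ∀ S ∈ G.edgeFinset.powerset,
      ((-1 : ℚ) ^ #S * (-1) ^ (Fintype.card V + numComponents S)) *
        MvPowerSeries.coeff d (powerSumPart (componentPartition S)).1 =
      ∑ κ ∈ coloringsOfWeight V d, if S ⊆ (monochromatic G κ).edgeFinset then
        (-1 : ℚ) ^ #S * (-1) ^ (Fintype.card V + numComponents S) else 0 := by
    intro S hS
    rw [coeff_powerSumPart_componentPartition G (mem_powerset.mp hS), ← sum_filter, sum_const,
      nsmul_eq_mul, mul_comm]
  rw [sum_congr rfl h2, sum_comm]
  refine sum_congr rfl fun κ _ => ?_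
  rw [← sum_filter, filter_powerset_edgeFinset, signedSum]
  push_cast
  rfl

end ChromSym

theorem mainTheorem3 {V : Type*} [Fintype V] (G : SimpleGraph V) :
    (ChromSym.omega (ChromSym.chromaticSymFun G) : MvPowerSeries ℕ+ ℚ) =
      ChromSym.formalSum (fun p : ChromSym.compatiblePairs G => ChromSym.weight p.1.2) := by
  classical
  ext d
  rw [ChromSym.coeff_omega_chromaticSymFun, ChromSym.coeff_compatiblePairs]
  refine Finset.sum_congr rfl fun κ _ => ?_
  rw [ChromSym.signedSum_edgeFinset, Int.cast_natCast]
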